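/- Let $d\ge 3$ and $n\ge 1$ be integers. A real $n^d$-tensor is a table $A=(a_{i_1\dots i_d})_{i_1,\dots,i_d=1}^{n}$ of real numbers. It is called symmetric if its entries are invariant under all permutations of the $d$ indices, and orthogonal if contracting $A$ in any $d-1$ of its $d$ modes with arbitrary vectors of $\mathbb{R}^n$ of Euclidean length one always results in a vector of Euclidean length one. For $\rho\in O(n)$ let $(\rho,\dots,\rho)\cdot A$ denote the tensor with entries $\sum_{j_1,\dots,j_d=1}^n \rho_{i_1j_1}\cdots\rho_{i_dj_d}\,a_{j_1\dots j_d}$. (i) If there is a symmetric orthogonal $n^d$-tensor, then $n=1$ or $n=2$. (ii) Let $C_d$ be the binary Chebyshev tensor, that is, the $2^d$-tensor whose entry with indices $i_1,\dots,i_d$ is $(-1)^k$ if exactly $2k$ of these indices are equal to $2$, and $0$ if the number of indices equal to $2$ is odd. A $2^d$-tensor $A$ is symmetric and orthogonal if and only if $A=(\rho,\dots,\rho)\cdot C_d$ for some $\rho\in O(2)$. Moreover, for a $2^d$-tensor $A$ and $\rho\in O(2)$, one has $A=(\rho,\dots,\rho)\cdot C_d$ if and only if $A$ is symmetric and its form $p_A(x)=\sum_{i_1,\dots,i_d=1}^{2}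 a_{i_1\dots i_d}x_{i_1}\cdots x_{i_d}$ is the rotated Chebyshev form, $p_A(x)=T_d(\rho^{-1}x)$ for all $x\in\mathbb{R}^2$, where $$T_d(x_1,x_2)=\sum_{k=0}^{\lfloor d/2\rfloor}\binom{d}{2k}(-1)^k x_1^{d-2k}x_2^{2k}.$$ -/

import Mathlib

/-- Real `n^d`-tensors: tables `A = (a_{i_1 … i_d})` with `d` indices, each running over `n` values. -/
abbrev CubeTensor (d n : ℕ) : Type := (Fin d → Fin n) → ℝ

namespace CubeTensor

variable {d n : ℕ}

/-- `A` is symmetric: its entries are invariant under every permutation of the `d` indices. -/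
def IsSymm (A : CubeTensor d n) : Prop :=
  ∀ (σ : Equiv.Perm (Fin d)) (i : Fin d → Fin n), A (i ∘ σ) = A i

/-- Contraction of `A` in all modes except the mode `j` with the vectors `x l`, `l ≠ j`
(the vector `x j` plays no role). The result is the vector in `ℝⁿ` with coordinates
`∑_{i : i_j = k} a_{i_1 … i_d} ∏_{l ≠ j} (x l)_{i_l}`. -/
noncomputable def contract (A : CubeTensor d n) (j : Fin d)
    (x : Fin d → EuclideanSpace ℝ (Fin n)) : EuclideanSpace ℝ (Fin n) :=
  WithLp.toLp 2 fun k =>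
    ∑ i : Fin d → Fin n with i j = k, A i * ∏ l ∈ Finset.univ.erase j, x l (i l)

/-- `A` is orthogonal: contracting it with Euclidean unit vectors in any `d - 1` of its modes
always gives a Euclidean unit vector. -/
def IsOrthogonal (A : CubeTensor d n) : Prop :=
  ∀ (j : Fin d) (x : Fin d → EuclideanSpace ℝ (Fin n)),
    (∀ l, l ≠ j → ‖x l‖ = 1) → ‖A.contract j x‖ = 1

/-- The multilinear action of `d`-tuples of matrices on tensors,
`((ρ₁, …, ρ_d) · A)_{i_1 … i_d} = ∑_{j_1, …, j_d} (ρ₁)_{i_1 j_1} ⋯ (ρ_d)_{i_d j_d} a_{j_1 … j_d}`. -/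
def act (ρ : Fin d → Matrix (Fin n) (Fin n) ℝ) (A : CubeTensor d n) : CubeTensor d n :=
  fun i => ∑ j : Fin d → Fin n, (∏ l, ρ l (i l) (j l)) * A j

/-- The form `p_A(x) = ∑ a_{i_1 … i_d} x_{i_1} ⋯ x_{i_d}` of a tensor `A`. -/
def form (A : CubeTensor d n) (x : Fin n → ℝ) : ℝ :=
  ∑ i : Fin d → Fin n, A i * ∏ l, x (i l)

/-- The binary Chebyshev tensor of order `d`: its entry is `(-1)^k` if the second index value
(here `1 : Fin 2`) occurs exactly `2k` times, and `0` if it occurs an odd number of times. -/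
def chebyshev (d : ℕ) : CubeTensor d 2 := fun i =>
  if Even (Finset.univ.filter fun l => i l = 1).card then
    (-1) ^ ((Finset.univ.filter fun l => i l = 1).card / 2)
  else 0

end CubeTensor

/-- The binary Chebyshev form
`∑_{k=0}^{⌊d/2⌋} (d choose 2k) (-1)^k x₁^(d-2k) x₂^(2k) = ((x₁ + i x₂)^d + (x₁ - i x₂)^d) / 2`. -/
def chebyshevForm (d : ℕ) (x : Fin 2 → ℝ) : ℝ :=
  ∑ k ∈ Finset.range (d / 2 + 1),
    (d.choose (2 * k) : ℝ) * (-1) ^ k * x 0 ^ (d - 2 * k) * x 1 ^ (2 * k)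

/-! Fill all modes but l, m, j with basis vectors, and let V(p,q) be the contraction with e_p, e_q
in modes l, m. Unit vectors (e_a+e_b)/√2 and (e_a-e_b)/√2 there give (V(a,a)-V(b,b))/2, the cross
terms cancelling by symmetry. So two unit vectors differ by norm 2, forcing V(a,a) = -V(b,b)
(`apply_update_update`). Three index values would give V(a,a) = -V(a,a) = 0, which is absurd; hence
n ≤ 2.

For n = 2 the sign rule determines the tensor from two entries, which form a unit complex number c
(`ext_of_apply_zero`). With ℝ² = ℂ, the multilinear form of C_d is Re ∏ z_l. This makes rotated
copies of C_d orthogonal, and a rotation by arg(c)/d matches the two entries.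

The statement on forms follows because a symmetric binary tensor can be read off from the
coefficients of its form. -/

namespace CubeTensor

variable {d n : ℕ}

/-- The multilinear form `(x₁, …, x_d) ↦ ∑ a_{i_1 … i_d} (x₁)_{i_1} ⋯ (x_d)_{i_d}` of a tensor. -/
noncomputable def multiform (A : CubeTensor d n) :
    MultilinearMap ℝ (fun _ : Fin d => EuclideanSpace ℝ (Fin n)) ℝ :=
  ∑ i : Fin d → Fin n, A i • (MultilinearMap.mkPiAlgebra ℝ (Fin d) ℝ).compLinearMap
    fun l => (EuclideanSpace.proj (i l) : EuclideanSpace ℝ (Fin n) →L[ℝ] ℝ).toLinearMap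

theorem multiform_apply (A : CubeTensor d n) (x : Fin d → EuclideanSpace ℝ (Fin n)) :
    A.multiform x = ∑ i : Fin d → Fin n, A i * ∏ l, x l (i l) := by
  simp [multiform]

theorem multiform_single (A : CubeTensor d n) (i : Fin d → Fin n) :
    A.multiform (fun l => EuclideanSpace.single (i l) (1 : ℝ)) = A i := by
  rw [multiform_apply, Finset.sum_eq_single i]
  · simp
  · intro j _ hj
    obtain ⟨l, hl⟩ := Function.ne_iff.mp hj
    rw [Finset.prod_eq_zero (Finset.mem_univ l), mul_zero]
    simp [hl]
  · simp

theorem contract_apply (A : CubeTensor d n) (j : Fin d)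
    (x : Fin d → EuclideanSpace ℝ (Fin n)) (k : Fin n) :
    A.contract j x k = A.multiform (Function.update x j (EuclideanSpace.single k 1)) := by
  rw [multiform_apply]
  simp only [contract]
  rw [Finset.sum_filter]
  refine Finset.sum_congr rfl fun i _ => ?_
  rw [← Finset.mul_prod_erase _ _ (Finset.mem_univ j)]
  have h : ∏ l ∈ Finset.univ.erase j,
      Function.update x j (EuclideanSpace.single k (1 : ℝ)) l (i l) =
      ∏ l ∈ Finset.univ.erase j, x l (i l) :=
    Finset.prod_congr rfl fun l hl => by
      rw [Function.update_of_ne (Finset.ne_of_mem_erase hl)]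
  rw [h, Function.update_self]
  by_cases hk : i j = k <;> simp [hk]

theorem contract_update_add (A : CubeTensor d n) {j l : Fin d} (hl : l ≠ j)
    (x : Fin d → EuclideanSpace ℝ (Fin n)) (u v : EuclideanSpace ℝ (Fin n)) :
    A.contract j (Function.update x l (u + v)) =
      A.contract j (Function.update x l u) + A.contract j (Function.update x l v) := by
  ext k
  simp only [contract_apply, PiLp.add_apply, Function.update_comm hl, MultilinearMap.map_update_add]

theorem contract_update_smul (A : CubeTensor d n) {j l : Fin d} (hl : l ≠ j)
    (x : Fin d → EuclideanSpace ℝ (Fin n)) (c : ℝ) (u : EuclideanSpace ℝ (Fin n)) :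
    A.contract j (Function.update x l (c • u)) = c • A.contract j (Function.update x l u) := by
  ext k
  simp only [contract_apply, PiLp.smul_apply, Function.update_comm hl,
    MultilinearMap.map_update_smul]

theorem contract_single_apply (A : CubeTensor d n) (j : Fin d) (i : Fin d → Fin n) (k : Fin n) :
    A.contract j (fun l => EuclideanSpace.single (i l) (1 : ℝ)) k = A (Function.update i j k) := by
  rw [contract_apply, ← multiform_single A]
  congr 1
  ext1 l
  by_cases hl : l = j
  · subst hl; simp
  · simp [hl]

theorem update_single (i : Fin d → Fin n) (l : Fin d) (a : Fin n) :
    Function.update (fun m => EuclideanSpace.single (i m) (1 : ℝ)) l (EuclideanSpace.single a 1) =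
      fun m => EuclideanSpace.single (Function.update i l a m) (1 : ℝ) := by
  ext1 m
  by_cases hm : m = l
  · subst hm; simp
  · simp [hm]

/-! ### The sign rule and the bound on n -/

theorem norm_add_single {a b : Fin n} (hab : a ≠ b) (c : ℝ) (hc : c ^ 2 = 1) :
    ‖(√2)⁻¹ • (EuclideanSpace.single a (1 : ℝ) + c • EuclideanSpace.single b (1 : ℝ))‖ = 1 := by
  have h : ‖EuclideanSpace.single a (1 : ℝ) + c • EuclideanSpace.single b (1 : ℝ)‖ ^ 2 = 2 := by
    rw [norm_add_sq_real, norm_smul, inner_smul_right, mul_pow, Real.norm_eq_abs, sq_abs, hc]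
    simp [EuclideanSpace.inner_single_left, hab]
    norm_num
  rw [norm_smul, ← Real.sqrt_sq (norm_nonneg (EuclideanSpace.single a (1 : ℝ) + _)), h]
  simp [abs_of_nonneg (Real.sqrt_nonneg 2)]

/-- By the parallelogram law, ‖p + q‖² = 2 + 2 - 4 = 0. -/
theorem eq_neg_of_norm_sub_eq_two {E : Type*} [NormedAddCommGroup E] [InnerProductSpace ℝ E]
    {p q : E} (hp : ‖p‖ = 1) (hq : ‖q‖ = 1) (h : ‖p - q‖ = 2) : p = -q := by
  have h1 := norm_sub_sq_real p q
  have h2 := norm_add_sq_real p q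
  rw [hp, hq, h] at h1
  rw [hp, hq] at h2
  have h3 : ‖p + q‖ ^ 2 = 0 := by linarith
  exact eq_neg_of_add_eq_zero_left (norm_eq_zero.mp (pow_eq_zero_iff two_ne_zero |>.mp h3))

/-- Changing two equal indices `a` into `b ≠ a` changes the sign of the entry of a symmetric
orthogonal tensor, provided there is a third index. -/
theorem IsOrthogonal.apply_update_update {A : CubeTensor d n} (hS : A.IsSymm)
    (hO : A.IsOrthogonal) {l m j : Fin d} (hlm : l ≠ m) (hlj : l ≠ j) (hmj : m ≠ j)
    {a b : Fin n} (hab : a ≠ b) (i : Fin d → Fin n) :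
    A (Function.update (Function.update i l a) m a) =
      -A (Function.update (Function.update i l b) m b) := by
  set V : Fin n → Fin n → EuclideanSpace ℝ (Fin n) := fun p q =>
    A.contract j (fun s => EuclideanSpace.single
      (Function.update (Function.update i l p) m q s) (1 : ℝ)) with hV
  have hV1 : ∀ p q, ‖V p q‖ = 1 := fun p q => hO j _ fun s _ => by simp
  -- The transposition of l and m fixes the free mode j.
  have hsymm : V a b = V b a := by
    ext k
    simp only [hV, contract_single_apply]
    rw [← hS (Equiv.swap l m)]
    congr 1
    ext1 s
    simp only [Function.comp_apply, Equiv.swap_apply_def]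
    by_cases h1 : s = l
    · subst h1; simp [hlj, hmj, hlm]
    · by_cases h2 : s = m
      · subst h2; simp [h1, hlj, hmj, hlm]
      · simp [h1, h2, Function.update_apply]
  set e : Fin n → EuclideanSpace ℝ (Fin n) := fun k => EuclideanSpace.single k (1 : ℝ) with he
  have hc : A.contract j (Function.update (Function.update (fun s => e (i s)) l
      ((√2)⁻¹ • (e a + (1 : ℝ) • e b))) m ((√2)⁻¹ • (e a + (-1 : ℝ) • e b))) =
      (2 : ℝ)⁻¹ • (V a a - V b b) := by
    have h2 : (√2)⁻¹ * (√2)⁻¹ = (2 : ℝ)⁻¹ := by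
      rw [← mul_inv, Real.mul_self_sqrt (by norm_num)]
    have hupd : ∀ p q, A.contract j (Function.update (Function.update (fun s => e (i s)) l (e p))
        m (e q)) = V p q := fun p q => by simp only [he, hV, update_single]
    have hl2 : ∀ u q, A.contract j (Function.update (Function.update (fun s => e (i s)) l u) m q) =
        A.contract j (Function.update (Function.update (fun s => e (i s)) m q) l u) :=
      fun u q => by rw [Function.update_comm hlm]
    rw [contract_update_smul _ hmj, contract_update_add _ hmj, contract_update_smul _ hmj]
    simp only [hl2, contract_update_smul _ hlj, contract_update_add _ hlj]
    simp only [← hl2, hupd, hsymm, ← h2, mul_smul]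
    module
  have hn : ‖(2 : ℝ)⁻¹ • (V a a - V b b)‖ = 1 := by
    rw [← hc]
    refine hO j _ fun s _ => ?_
    by_cases h2 : s = m
    · subst h2
      rw [Function.update_self]
      exact norm_add_single hab _ (by norm_num)
    · rw [Function.update_of_ne h2]
      by_cases h1 : s = l
      · subst h1
        rw [Function.update_self]
        exact norm_add_single hab _ (by norm_num)
      · simp [h1, he]
  have hn2 : ‖V a a - V b b‖ = 2 := by
    rw [norm_smul] at hn
    norm_num at hn
    linarith
  have hfin := congrArg (fun v : EuclideanSpace ℝ (Fin n) => v (i j))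
    (eq_neg_of_norm_sub_eq_two (hV1 a a) (hV1 b b) hn2)
  have hu : ∀ p, Function.update (Function.update (Function.update i l p) m p) j (i j) =
      Function.update (Function.update i l p) m p := fun p => by
    rw [Function.update_eq_self_iff, Function.update_of_ne hmj.symm, Function.update_of_ne hlj.symm]
  simpa only [hV, contract_single_apply, PiLp.neg_apply, hu] using hfin

theorem IsOrthogonal.dim_le_two (hd : 3 ≤ d) {A : CubeTensor d n} (hS : A.IsSymm)
    (hO : A.IsOrthogonal) : n ≤ 2 := by
  by_contra! hn
  let l : Fin d := ⟨0, by omega⟩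
  let m : Fin d := ⟨1, by omega⟩
  let j : Fin d := ⟨2, by omega⟩
  have hlm : l ≠ m := by simp [l, m]
  have hlj : l ≠ j := by simp [l, j]
  have hmj : m ≠ j := by simp [m, j]
  let a : Fin n := ⟨0, by omega⟩
  let b : Fin n := ⟨1, by omega⟩
  let c : Fin n := ⟨2, by omega⟩
  have hab : a ≠ b := by simp [a, b]
  have hbc : b ≠ c := by simp [b, c]
  have hca : c ≠ a := by simp [a, c]
  -- Three sign changes around the cycle a, b, c, a return the entry to its own negative.
  have hzero : ∀ i, A (Function.update (Function.update i l a) m a) = 0 := fun i => by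
    have h1 := hO.apply_update_update hS hlm hlj hmj hab i
    have h2 := hO.apply_update_update hS hlm hlj hmj hbc i
    have h3 := hO.apply_update_update hS hlm hlj hmj hca i
    linarith
  have hnorm := hO j (fun _ => EuclideanSpace.single a (1 : ℝ)) fun s _ => by simp
  have hv : A.contract j (fun _ => EuclideanSpace.single a (1 : ℝ)) = 0 := by
    ext k
    rw [contract_single_apply A j (fun _ => a) k, PiLp.zero_apply,
      ← hzero (Function.update (fun _ => a) j k)]
    congr 1
    rw [eq_comm, Function.update_eq_self_iff.mpr, Function.update_eq_self_iff.mpr] <;>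
      simp [hlj, hmj, Function.update_apply]
  rw [hv, norm_zero] at hnorm
  exact zero_ne_one hnorm

/-! ### The matrix action and the complex description of the Chebyshev tensor -/

theorem sum_sq_contract (A : CubeTensor d n) (j : Fin d)
    (x : Fin d → EuclideanSpace ℝ (Fin n)) : ‖A.contract j x‖ ^ 2 = ∑ k, A.contract j x k ^ 2 := by
  rw [EuclideanSpace.norm_sq_eq]
  simp

theorem form_eq_multiform (A : CubeTensor d n) (x : Fin n → ℝ) :
    A.form x = A.multiform fun _ => WithLp.toLp 2 x := by
  simp [form, multiform_apply]

theorem multiform_act (ρ : Fin d → Matrix (Fin n) (Fin n) ℝ) (A : CubeTensor d n)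
    (x : Fin d → EuclideanSpace ℝ (Fin n)) :
    (act ρ A).multiform x = A.multiform fun l => WithLp.toLp 2 ((ρ l).transpose.mulVec (x l)) := by
  simp only [multiform_apply, act, Finset.sum_mul, Matrix.mulVec, dotProduct,
    Matrix.transpose_apply]
  rw [Finset.sum_comm]
  refine Finset.sum_congr rfl fun j _ => ?_
  rw [Finset.prod_univ_sum, Fintype.piFinset_univ, Finset.mul_sum]
  refine Finset.sum_congr rfl fun i _ => ?_
  rw [Finset.prod_mul_distrib]
  ring

theorem IsSymm.act {A : CubeTensor d n} (hS : A.IsSymm) (ρ : Matrix (Fin n) (Fin n) ℝ) :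
    (CubeTensor.act (fun _ => ρ) A).IsSymm := by
  intro σ i
  simp only [CubeTensor.act]
  refine Fintype.sum_equiv (Equiv.arrowCongr σ (Equiv.refl _)) _ _ fun j => ?_
  have h : (Equiv.arrowCongr σ (Equiv.refl (Fin n))) j = j ∘ σ.symm := rfl
  rw [h, hS]
  congr 1
  exact Fintype.prod_equiv σ _ _ fun l => by simp

theorem isSymm_chebyshev (d : ℕ) : (chebyshev d).IsSymm := by
  intro σ i
  have h : (Finset.univ.filter fun l => (i ∘ σ) l = 1).card =
      (Finset.univ.filter fun l => i l = 1).card := by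
    simp only [Finset.card_filter, Function.comp_apply]
    exact Fintype.sum_equiv σ _ _ fun l => rfl
  simp only [chebyshev, h]

theorem re_I_pow (m : ℕ) :
    (Complex.I ^ m).re = if Even m then (-1 : ℝ) ^ (m / 2) else 0 := by
  obtain ⟨k, rfl | rfl⟩ := Nat.even_or_odd' m
  · have : ((-1 : ℂ) ^ k).re = (-1) ^ k := by exact_mod_cast Complex.ofReal_re ((-1) ^ k)
    simp [pow_mul, this]
  · have : ((-1 : ℂ) ^ k).im = 0 := by exact_mod_cast Complex.ofReal_im ((-1) ^ k)
    simp [pow_succ, pow_mul, this]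

/-- Each index with the second value contributes a factor I, so the entry is the real part of a
power of I. -/
theorem chebyshev_apply (i : Fin d → Fin 2) :
    chebyshev d i = (∏ l, if i l = 1 then Complex.I else 1).re := by
  rw [Finset.prod_ite, Finset.prod_const, Finset.prod_const_one, mul_one, re_I_pow]
  rfl

/-- The multilinear form of the Chebyshev tensor is the real part of the product of
complex numbers. -/
theorem multiform_chebyshev (x : Fin d → EuclideanSpace ℝ (Fin 2)) :
    (chebyshev d).multiform x = (∏ l, (x l 0 + x l 1 * Complex.I)).re := by
  have h : ∀ l, (x l 0 + x l 1 * Complex.I : ℂ) =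
      ∑ k : Fin 2, (if k = 1 then Complex.I else 1) * (x l k : ℂ) := fun l => by
    simp [Fin.sum_univ_two, mul_comm]
  simp only [h]
  rw [Finset.prod_univ_sum, Fintype.piFinset_univ, Complex.re_sum, multiform_apply]
  refine Finset.sum_congr rfl fun i _ => ?_
  rw [Finset.prod_mul_distrib, ← Complex.ofReal_prod, Complex.re_mul_ofReal, ← chebyshev_apply]

theorem re_add_mul_I_pow (d : ℕ) (x y : ℝ) :
    ((x + y * Complex.I) ^ d).re = chebyshevForm d ![x, y] := by
  have hterm : ∀ m, ((y * Complex.I) ^ m * (x : ℂ) ^ (d - m) * (d.choose m : ℂ)).re =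
      if Even m then (d.choose m : ℝ) * (-1) ^ (m / 2) * x ^ (d - m) * y ^ m else 0 := by
    intro m
    have h : ((y * Complex.I) ^ m * (x : ℂ) ^ (d - m) * (d.choose m : ℂ)) =
        Complex.I ^ m * ((y ^ m * x ^ (d - m) * d.choose m : ℝ) : ℂ) := by
      push_cast; ring
    rw [h, Complex.re_mul_ofReal, re_I_pow]
    split_ifs <;> ring
  rw [add_comm, add_pow, Complex.re_sum]
  simp only [hterm]
  rw [← Finset.sum_filter, chebyshevForm]
  refine (Finset.sum_bij (fun k _ => 2 * k) ?_ ?_ ?_ ?_).symm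
  · intro k hk
    simp only [Finset.mem_range, Finset.mem_filter] at hk ⊢
    exact ⟨by omega, even_two_mul k⟩
  · intro k _ l _ h
    omega
  · intro m hm
    simp only [Finset.mem_range, Finset.mem_filter] at hm
    obtain ⟨hm, k, rfl⟩ := hm
    exact ⟨k, by simp only [Finset.mem_range]; omega, by omega⟩
  · intro k _
    simp

theorem transpose_mulVec_single (ρ : Matrix (Fin n) (Fin n) ℝ) (k m : Fin n) :
    ρ.transpose.mulVec (EuclideanSpace.single k (1 : ℝ)) m = ρ k m := by
  simp [Matrix.mulVec, dotProduct]

theorem norm_sq_transpose_mulVec {ρ : Matrix (Fin 2) (Fin 2) ℝ}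
    (hρ : ρ ∈ Matrix.orthogonalGroup (Fin 2) ℝ) (x : EuclideanSpace ℝ (Fin 2)) :
    ‖((ρ.transpose.mulVec x 0 : ℝ) + (ρ.transpose.mulVec x 1 : ℝ) * Complex.I : ℂ)‖ ^ 2 =
      ‖x‖ ^ 2 := by
  have h := (Matrix.mem_orthogonalGroup_iff (Fin 2) ℝ).mp hρ
  have h00 := congrFun (congrFun h 0) 0
  have h01 := congrFun (congrFun h 0) 1
  have h11 := congrFun (congrFun h 1) 1
  simp [Matrix.mul_apply, Fin.sum_univ_two] at h00 h01 h11
  rw [Complex.sq_norm, Complex.normSq_add_mul_I, EuclideanSpace.norm_sq_eq]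
  simp [Matrix.mulVec, dotProduct, Fin.sum_univ_two]
  linear_combination x 0 ^ 2 * h00 + 2 * x 0 * x 1 * h01 + x 1 ^ 2 * h11

/-- The transpose of ρ preserves norms, so the contracted vectors become complex numbers with
product w of modulus one; the contraction is ρ applied to (Re w, -Im w). -/
theorem isOrthogonal_act_chebyshev {ρ : Matrix (Fin 2) (Fin 2) ℝ}
    (hρ : ρ ∈ Matrix.orthogonalGroup (Fin 2) ℝ) :
    (act (fun _ => ρ) (chebyshev d)).IsOrthogonal := by
  intro j x hx
  set z : EuclideanSpace ℝ (Fin 2) → ℂ := fun y =>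
    (ρ.transpose.mulVec y 0 : ℝ) + (ρ.transpose.mulVec y 1 : ℝ) * Complex.I with hz
  set w : ℂ := ∏ l ∈ Finset.univ.erase j, z (x l) with hw
  have hwn : ‖w‖ = 1 := by
    rw [hw, norm_prod]
    refine Finset.prod_eq_one fun l hl => ?_
    have h := norm_sq_transpose_mulVec hρ (x l)
    rw [hx l (Finset.ne_of_mem_erase hl), one_pow] at h
    exact (pow_eq_one_iff_of_nonneg (norm_nonneg _) two_ne_zero).mp h
  have hk : ∀ k, (act (fun _ => ρ) (chebyshev d)).contract j x k =
      ρ k 0 * w.re - ρ k 1 * w.im := by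
    intro k
    rw [contract_apply, multiform_act, multiform_chebyshev,
      ← Finset.mul_prod_erase _ _ (Finset.mem_univ j), Function.update_self]
    have : ∏ l ∈ Finset.univ.erase j, z (Function.update x j (EuclideanSpace.single k 1) l) = w :=
      Finset.prod_congr rfl fun l hl => by
        rw [Function.update_of_ne (Finset.ne_of_mem_erase hl)]
    simp only [hz] at this
    simp only [this, transpose_mulVec_single]
    simp
  have h := (Matrix.mem_orthogonalGroup_iff' (Fin 2) ℝ).mp hρ
  have h00 := congrFun (congrFun h 0) 0
  have h01 := congrFun (congrFun h 0) 1
  have h11 := congrFun (congrFun h 1) 1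
  simp [Matrix.mul_apply, Fin.sum_univ_two] at h00 h01 h11
  have hw2 : w.re * w.re + w.im * w.im = 1 := by
    rw [← Complex.normSq_apply, ← Complex.sq_norm, hwn, one_pow]
  have hsq : ‖(act (fun _ => ρ) (chebyshev d)).contract j x‖ ^ 2 = 1 := by
    rw [sum_sq_contract, Fin.sum_univ_two, hk, hk]
    linear_combination w.re ^ 2 * h00 - 2 * w.re * w.im * h01 + w.im ^ 2 * h11 + hw2
  exact (pow_eq_one_iff_of_nonneg (norm_nonneg _) two_ne_zero).mp hsq

/-! ### Classification of binary symmetric orthogonal tensors -/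

/-- A binary symmetric orthogonal tensor is determined by its entries with at most one index
equal to the second value. -/
theorem IsOrthogonal.ext_of_apply_zero {A B : CubeTensor d 2} (hd : 3 ≤ d)
    (hSA : A.IsSymm) (hOA : A.IsOrthogonal) (hSB : B.IsSymm) (hOB : B.IsOrthogonal)
    (h0 : A (fun _ => 0) = B (fun _ => 0)) (p : Fin d)
    (h1 : A (Function.update (fun _ => 0) p 1) = B (Function.update (fun _ => 0) p 1)) :
    A = B := by
  -- Induction on the number of ones: the sign rule turns two of them into zeros, using a third mode
  -- j that exists because 3 ≤ d.
  have key : ∀ (m : ℕ) (i : Fin d → Fin 2),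
      (Finset.univ.filter fun l => i l = 1).card = m → A i = B i := by
    intro m
    induction m using Nat.strong_induction_on with
    | _ m ih =>
      intro i hi
      rcases Nat.lt_or_ge 1 m with hm | hm
      · rw [← hi, Finset.one_lt_card] at hm
        obtain ⟨l, hl, q, hq, hlq⟩ := hm
        simp only [Finset.mem_filter, Finset.mem_univ, true_and] at hl hq
        obtain ⟨j, hj⟩ : ∃ j : Fin d, j ∉ ({l, q} : Finset (Fin d)) := by
          by_contra! hall
          have h := Finset.card_le_card fun j (_ : j ∈ Finset.univ) => hall j
          rw [Finset.card_univ, Fintype.card_fin] at h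
          have := Finset.card_le_two (a := l) (b := q)
          omega
        simp only [Finset.mem_insert, Finset.mem_singleton, not_or] at hj
        have hii : Function.update (Function.update i l 1) q 1 = i := by
          rw [← hl, Function.update_eq_self, hl, ← hq, Function.update_eq_self]
        have ha := hOA.apply_update_update hSA hlq (Ne.symm hj.1) (Ne.symm hj.2) one_ne_zero i
        have hb := hOB.apply_update_update hSB hlq (Ne.symm hj.1) (Ne.symm hj.2) one_ne_zero i
        rw [hii] at ha hb
        rw [ha, hb, ih _ _ _ rfl]
        rw [← hi]
        refine Finset.card_lt_card ⟨fun s hs => ?_, fun hsub => ?_⟩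
        · simp only [Finset.mem_filter, Finset.mem_univ, true_and, Function.update_apply] at hs ⊢
          split_ifs at hs <;> simp_all
        · have := hsub (Finset.mem_filter.mpr ⟨Finset.mem_univ q, hq⟩)
          simp at this
      · rcases Nat.le_one_iff_eq_zero_or_eq_one.mp hm with rfl | rfl
        · have : i = fun _ => 0 := by
            ext1 l
            by_contra hl
            rw [Finset.card_eq_zero] at hi
            exact Finset.eq_empty_iff_forall_notMem.mp hi l
              (Finset.mem_filter.mpr ⟨Finset.mem_univ l, Fin.eq_one_of_ne_zero _ hl⟩)
          rw [this, h0]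
        · obtain ⟨l, hl⟩ := Finset.card_eq_one.mp hi
          have hmem : ∀ s, i s = 1 ↔ s = l := fun s => by
            simpa using Finset.ext_iff.mp hl s
          -- Symmetry moves the only one to position p.
          have : i ∘ Equiv.swap l p = Function.update (fun _ => 0) p 1 := by
            ext1 s
            by_cases hs : s = p
            · subst hs
              simp [(hmem l).mpr rfl]
            · rw [Function.update_of_ne hs, Function.comp_apply]
              by_contra hne
              have := (hmem _).mp (Fin.eq_one_of_ne_zero _ hne)
              rw [Equiv.swap_apply_eq_iff, Equiv.swap_apply_left] at this
              exact hs this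
          rw [← hSA (Equiv.swap l p), ← hSB (Equiv.swap l p), this, h1]
  ext1 i
  exact key _ i rfl

theorem act_chebyshev_apply (ρ : Matrix (Fin 2) (Fin 2) ℝ) (i : Fin d → Fin 2) :
    act (fun _ => ρ) (chebyshev d) i =
      (∏ l, ((ρ (i l) 0 : ℂ) + (ρ (i l) 1 : ℂ) * Complex.I)).re := by
  rw [← multiform_single (act _ _), multiform_act, multiform_chebyshev]
  simp only [transpose_mulVec_single]

theorem IsOrthogonal.exists_eq_act_chebyshev {A : CubeTensor d 2} (hd : 3 ≤ d)
    (hS : A.IsSymm) (hO : A.IsOrthogonal) :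
    ∃ ρ ∈ Matrix.orthogonalGroup (Fin 2) ℝ, A = act (fun _ => ρ) (chebyshev d) := by
  let p : Fin d := ⟨0, by omega⟩
  set c : ℂ := ⟨A (fun _ => 0), A (Function.update (fun _ => 0) p 1)⟩ with hc
  have hcn : ‖c‖ = 1 := by
    have h := hO p (fun _ => EuclideanSpace.single 0 1) fun _ _ => by simp
    have h2 := sum_sq_contract A p (fun _ => EuclideanSpace.single 0 1)
    rw [h, Fin.sum_univ_two, contract_single_apply A p (fun _ => 0),
      contract_single_apply A p (fun _ => 0), Function.update_eq_self] at h2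
    have h3 : ‖c‖ ^ 2 = 1 := by
      rw [Complex.sq_norm, Complex.normSq_apply, hc]
      linarith
    exact (pow_eq_one_iff_of_nonneg (norm_nonneg _) two_ne_zero).mp h3
  have hd0 : (d : ℝ) ≠ 0 := by positivity
  -- The rows of ρ become z = exp(-iθ) and I * z. The two entries to match are then Re(z^d) and Re(I
  -- * z^d), equal to Re c and Im c once z^d is the conjugate of c.
  set θ : ℝ := c.arg / d with hθ
  have hdθ : (d : ℝ) * θ = c.arg := by rw [hθ]; field_simp
  set ρ : Matrix (Fin 2) (Fin 2) ℝ := !![Real.cos θ, -Real.sin θ; Real.sin θ, Real.cos θ] with hρ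
  have hcs := Real.sin_sq_add_cos_sq θ
  have hρO : ρ ∈ Matrix.orthogonalGroup (Fin 2) ℝ := by
    rw [Matrix.mem_orthogonalGroup_iff]
    ext a b
    fin_cases a <;> fin_cases b <;>
      simp [hρ, Matrix.mul_apply, Fin.sum_univ_two] <;> linarith
  set z : ℂ := Complex.exp (-(θ * Complex.I)) with hz
  have hz0 : (ρ 0 0 : ℂ) + (ρ 0 1 : ℂ) * Complex.I = z := by
    rw [hz, ← neg_mul, Complex.exp_mul_I]
    simp [hρ, Complex.cos_neg, Complex.sin_neg]
  have hz1 : (ρ 1 0 : ℂ) + (ρ 1 1 : ℂ) * Complex.I = Complex.I * z := by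
    rw [← hz0]
    simp [hρ]
    linear_combination (Complex.sin θ) * Complex.I_sq
  have hzd : z ^ d = starRingEnd ℂ c := by
    have h := Complex.norm_mul_exp_arg_mul_I c
    rw [hcn, Complex.ofReal_one, one_mul] at h
    rw [hz, ← Complex.exp_nat_mul, ← h, ← Complex.exp_conj, ← hdθ]
    congr 1
    simp [mul_assoc]
  refine ⟨ρ, hρO, hO.ext_of_apply_zero hd hS ((isSymm_chebyshev d).act ρ)
    (isOrthogonal_act_chebyshev hρO) ?_ p ?_⟩
  · rw [act_chebyshev_apply]
    simp [hz0, hzd, hc]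
  · rw [act_chebyshev_apply, ← Finset.mul_prod_erase _ _ (Finset.mem_univ p)]
    have h : ∏ l ∈ Finset.univ.erase p,
        ((ρ (Function.update (fun _ => (0 : Fin 2)) p 1 l) 0 : ℂ) +
          (ρ (Function.update (fun _ => (0 : Fin 2)) p 1 l) 1 : ℂ) * Complex.I) =
        ∏ l ∈ Finset.univ.erase p, z :=
      Finset.prod_congr rfl fun l hl => by
        rw [Function.update_of_ne (Finset.ne_of_mem_erase hl), hz0]
    rw [h, Function.update_self, hz1, mul_assoc, Finset.mul_prod_erase _ (fun _ => z)
      (Finset.mem_univ p), Finset.prod_const, Finset.card_univ, Fintype.card_fin, hzd]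
    simp [hc]

/-! ### Symmetric binary tensors and their forms -/

theorem exists_perm_of_card_eq {i j : Fin d → Fin 2}
    (h : (Finset.univ.filter fun l => i l = 1).card = (Finset.univ.filter fun l => j l = 1).card) :
    ∃ σ : Equiv.Perm (Fin d), i ∘ σ = j := by
  have h1 : Fintype.card {l // j l = 1} = Fintype.card {l // i l = 1} := by
    rw [Fintype.card_subtype, Fintype.card_subtype, h]
  have h0 : Fintype.card {l // j l = 0} = Fintype.card {l // i l = 0} := by
    have hi := Fintype.card_subtype_compl fun l => i l = 1
    have hj := Fintype.card_subtype_compl fun l => j l = 1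
    rw [← h1, ← hj] at hi
    have e : ∀ a : Fin 2, ¬a = 1 ↔ a = 0 := by decide
    simpa only [e] using hi.symm
  have he : ∀ c : Fin 2, Nonempty ({l // j l = c} ≃ {l // i l = c}) := fun c => by
    fin_cases c
    · exact ⟨Fintype.equivOfCardEq h0⟩
    · exact ⟨Fintype.equivOfCardEq h1⟩
  exact ⟨Equiv.ofFiberEquiv fun c => (he c).some, funext fun l => Equiv.ofFiberEquiv_map _ l⟩

/-- A binary symmetric tensor is determined by its form. -/
theorem IsSymm.ext_of_form {A B : CubeTensor d 2} (hA : A.IsSymm) (hB : B.IsSymm)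
    (h : ∀ x, A.form x = B.form x) : A = B := by
  -- Dehomogenizing at (1, t) gives a polynomial in t whose exponents count ones.
  have hform : ∀ (C : CubeTensor d 2) (t : ℝ), C.form ![1, t] =
      (∑ i : Fin d → Fin 2, Polynomial.C (C i) *
        Polynomial.X ^ (Finset.univ.filter fun l => i l = 1).card).eval t := by
    intro C t
    rw [Polynomial.eval_finsetSum]
    refine Finset.sum_congr rfl fun i _ => ?_
    have hv : ∀ a : Fin 2, (![1, t] : Fin 2 → ℝ) a = if a = 1 then t else 1 := fun a => by
      fin_cases a <;> rfl
    simp [hv, Finset.prod_ite]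
  have hpoly := Polynomial.funext fun t => (hform A t).symm.trans ((h _).trans (hform B t))
  ext1 i
  have hcoeff := congrArg (fun P => Polynomial.coeff P
    (Finset.univ.filter fun l => i l = 1).card) hpoly
  -- Multi-indices with equally many ones are permutations of each other, so they share one entry;
  -- their number is positive and can be cancelled.
  have hval : ∀ C : CubeTensor d 2, C.IsSymm → (∑ j : Fin d → Fin 2, Polynomial.C (C j) *
        Polynomial.X ^ (Finset.univ.filter fun l => j l = 1).card).coeff
          (Finset.univ.filter fun l => i l = 1).card =
      (Finset.univ.filter fun j : Fin d → Fin 2 => (Finset.univ.filter fun l => i l = 1).card =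
        (Finset.univ.filter fun l => j l = 1).card).card * C i := by
    intro C hC
    rw [Polynomial.finsetSum_coeff]
    simp only [Polynomial.coeff_C_mul, Polynomial.coeff_X_pow, mul_ite, mul_one, mul_zero]
    rw [← Finset.sum_filter, ← nsmul_eq_mul, ← Finset.sum_const]
    refine Finset.sum_congr rfl fun j hj => ?_
    obtain ⟨σ, rfl⟩ := exists_perm_of_card_eq (Finset.mem_filter.mp hj).2
    exact hC σ i
  simp only [hval A hA, hval B hB] at hcoeff
  refine mul_left_cancel₀ (Nat.cast_ne_zero.mpr ?_) hcoeff
  exact (Finset.card_pos.mpr ⟨i, by simp⟩).ne'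

theorem form_act_chebyshev {ρ : Matrix (Fin 2) (Fin 2) ℝ}
    (hρ : ρ ∈ Matrix.orthogonalGroup (Fin 2) ℝ) (x : Fin 2 → ℝ) :
    (act (fun _ => ρ) (chebyshev d)).form x = chebyshevForm d (ρ⁻¹.mulVec x) := by
  have hinv : ρ⁻¹ = ρ.transpose :=
    Matrix.inv_eq_right_inv ((Matrix.mem_orthogonalGroup_iff (Fin 2) ℝ).mp hρ)
  rw [form_eq_multiform, multiform_act, multiform_chebyshev, hinv]
  simp only [Finset.prod_const, Finset.card_univ, Fintype.card_fin]
  rw [re_add_mul_I_pow]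
  congr 1
  ext k
  fin_cases k <;> rfl

end CubeTensor

theorem mainTheorem8 (d : ℕ) (hd : 3 ≤ d) :
    (∀ (n : ℕ), 1 ≤ n → ∀ (A : CubeTensor d n), A.IsSymm → A.IsOrthogonal → n = 1 ∨ n = 2) ∧
    (∀ (A : CubeTensor d 2),
      ((A.IsSymm ∧ A.IsOrthogonal) ↔
        ∃ ρ ∈ Matrix.orthogonalGroup (Fin 2) ℝ,
          A = CubeTensor.act (fun _ => ρ) (CubeTensor.chebyshev d)) ∧
      (∀ ρ ∈ Matrix.orthogonalGroup (Fin 2) ℝ,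
        (A = CubeTensor.act (fun _ => ρ) (CubeTensor.chebyshev d) ↔
          (A.IsSymm ∧ ∀ x : Fin 2 → ℝ, A.form x = chebyshevForm d (ρ⁻¹.mulVec x))))) := by
  refine ⟨fun n hn A hS hO => ?_, fun A => ⟨⟨fun h => h.2.exists_eq_act_chebyshev hd h.1, ?_⟩,
    fun ρ hρ => ⟨?_, fun h => ?_⟩⟩⟩
  · have := hO.dim_le_two hd hS
    omega
  · rintro ⟨ρ, hρ, rfl⟩
    exact ⟨(CubeTensor.isSymm_chebyshev d).act ρ, CubeTensor.isOrthogonal_act_chebyshev hρ⟩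
  · rintro rfl
    exact ⟨(CubeTensor.isSymm_chebyshev d).act ρ, CubeTensor.form_act_chebyshev hρ⟩
  · exact h.1.ext_of_form ((CubeTensor.isSymm_chebyshev d).act ρ) fun x => by
      rw [h.2 x, CubeTensor.form_act_chebyshev hρ]
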